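/- Let $\mathcal H$ be a complex Hilbert space of finite dimension $n\ge 3$, let $\mathcal P_1(\mathcal H)$ be the set of rank-one orthogonal projections on $\mathcal H$, and let $\phi:\mathcal P_1(\mathcal H)\to\mathcal P_1(\mathcal H)$ be a surjective map. For operators $A_1,\dots,A_k$ on $\mathcal H$ let $$\sigma([A_1,\dots,A_k])=\{(c_1,\dots,c_k)\in\mathbb C^k : c_1A_1+\dots+c_kA_k \text{ is not invertible in } \mathcal B(\mathcal H)\}$$ be their joint spectrum. We say that $\phi$ shrinks (respectively preserves) the joint spectrum of any $k$ projections if $\sigma([\phi(P_1),\dots,\phi(P_k)])\subseteq\sigma([P_1,\dots,P_k])$ (respectively $\sigma([\phi(P_1),\dots,\phi(P_k)])=\sigma([P_1,\dots,P_k])$) for all $P_1,\dots,P_k\in\mathcal P_1(\mathcal H)$. Then the following are equivalent: 1. there exists $k_0\ge n+1$ such that $\phi$ shrinks the joint spectrum of any $k_0$ projections; 2. there exists $k_0\ge n+1$ such that $\phi$ preserves the joint spectrum of any $k_0$ projections; 3. for every $k\ge n+1$, $\phi$ shrinks the joint spectrum of any $k$ projections; 4. for every $k\ge n+1$, $\phi$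 preserves the joint spectrum of any $k$ projections; 5. there exists a unitary or anti-unitary operator $U$ on $\mathcal H$ (anti-unitary: a conjugate-linear isometric bijection, with $U^*=U^{-1}$) such that $\phi(P)=U^*PU$ for all $P\in\mathcal P_1(\mathcal H)$. -/

import Mathlib

/-- The joint spectrum of a tuple of bounded operators: all coefficient vectors `c` for which
`c₁ A₁ + ⋯ + c_l A_l` is not invertible in `B(H)`. -/
def jointSpectrum {H : Type*} [NormedAddCommGroup H] [InnerProductSpace ℂ H] {l : ℕ}
    (A : Fin l → (H →L[ℂ] H)) : Set (Fin l → ℂ) :=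
  {c | ¬ IsUnit (∑ i, c i • A i)}

/-- The set of (orthogonal, i.e. self-adjoint idempotent) projections of rank one on `H`. -/
def RankOneProj (H : Type*) [NormedAddCommGroup H] [InnerProductSpace ℂ H] [CompleteSpace H] :
    Type _ :=
  {P : H →L[ℂ] H // IsStarProjection P ∧ Module.finrank ℂ P.range = 1}

/-- `φ` shrinks the joint spectrum of any `k` rank one projections (repetitions allowed). -/
def ShrinksJointSpectrum {H : Type*} [NormedAddCommGroup H] [InnerProductSpace ℂ H]
    [CompleteSpace H] (φ : RankOneProj H → RankOneProj H) (k : ℕ) : Prop :=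
  ∀ P : Fin k → RankOneProj H,
    jointSpectrum (fun i => (φ (P i)).1) ⊆ jointSpectrum (fun i => (P i).1)

/-- `φ` preserves the joint spectrum of any `k` rank one projections (repetitions allowed). -/
def PreservesJointSpectrum {H : Type*} [NormedAddCommGroup H] [InnerProductSpace ℂ H]
    [CompleteSpace H] (φ : RankOneProj H → RankOneProj H) (k : ℕ) : Prop :=
  ∀ P : Fin k → RankOneProj H,
    jointSpectrum (fun i => (φ (P i)).1) = jointSpectrum (fun i => (P i).1)

/-- `U* P U` for an anti-unitary `U`, i.e. a conjugate-linear isometric bijection of `H`.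
The adjoint `U*` of an anti-unitary, characterized by `⟪U* x, y⟫ = ⟪U y, x⟫`, is its inverse
`U.symm`; see `inner_antiunitary_symm_left`. -/
noncomputable def antiunitaryConj {H : Type*} [NormedAddCommGroup H] [InnerProductSpace ℂ H]
    (U : H ≃ₗᵢ⋆[ℂ] H) (P : H →L[ℂ] H) : H →L[ℂ] H :=
  (U.symm.toContinuousLinearEquiv : H →L⋆[ℂ] H).comp
    (P.comp (U.toContinuousLinearEquiv : H →L⋆[ℂ] H))

theorem antiunitaryConj_apply {H : Type*} [NormedAddCommGroup H] [InnerProductSpace ℂ H]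
    (U : H ≃ₗᵢ⋆[ℂ] H) (P : H →L[ℂ] H) (x : H) :
    antiunitaryConj U P x = U.symm (P (U x)) := rfl

/-- A conjugate-linear isometry reverses inner products. -/
theorem inner_antiunitary {H : Type*} [NormedAddCommGroup H] [InnerProductSpace ℂ H]
    (U : H ≃ₗᵢ⋆[ℂ] H) (x y : H) : inner ℂ (U x) (U y) = inner ℂ y x := by
  have hI : ∀ z : H, (Complex.I : ℂ) • U z = -U (Complex.I • z) := by
    intro z
    rw [LinearIsometryEquiv.map_smulₛₗ]
    simp
  have h2 : ‖U x - Complex.I • U y‖ = ‖x + Complex.I • y‖ := by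
    rw [hI, sub_neg_eq_add, ← map_add, U.norm_map]
  have h3 : ‖U x + Complex.I • U y‖ = ‖x - Complex.I • y‖ := by
    rw [hI, ← sub_eq_add_neg, ← map_sub, U.norm_map]
  have h4 : ‖U x + U y‖ = ‖x + y‖ := by rw [← map_add, U.norm_map]
  have h5 : ‖U x - U y‖ = ‖x - y‖ := by rw [← map_sub, U.norm_map]
  rw [← inner_conj_symm y x, inner_eq_sum_norm_sq_div_four, inner_eq_sum_norm_sq_div_four]
  simp only [RCLike.I_to_complex, Complex.coe_algebraMap, h4, h5] at *
  rw [h2, h3]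
  simp only [map_div₀, map_add, map_sub, map_mul, map_pow, Complex.conj_ofReal, Complex.conj_I,
    map_ofNat]
  ring

/-- The inverse of an anti-unitary is its adjoint. -/
theorem inner_antiunitary_symm_left {H : Type*} [NormedAddCommGroup H] [InnerProductSpace ℂ H]
    (U : H ≃ₗᵢ⋆[ℂ] H) (x y : H) : inner ℂ (U.symm x) y = inner ℂ (U y) x := by
  rw [← inner_antiunitary U y (U.symm x), U.apply_symm_apply]

/-! Let unit vectors `x i` form a basis and let `y = ∑ a i • x i` be a unit vector. For nonzero `t
i`, the combination of the projections onto the `x i` with weights `(t i)⁻¹`, minus the projection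
onto `y`, is singular exactly when `∑ t i |a i|² = 1` (`isUnit_sum_rankOne_sub_iff`). Shrinking
sends this hyperplane for the image configuration into the original one, which forces `|a i|` to be
the same before and after `φ` (`eq_of_forall_sum_mul_eq_one`).

Start from an orthonormal basis. By surjectivity every unit vector then has image-basis coefficients
of square sum one, so the image basis is orthonormal and transition probabilities are preserved.
Wigner's theorem, proved here from matrix entries, gives the operator `U`. Conversely, conjugation
by `U` preserves invertibility; in the anti-unitary case an adjoint repairs the conjugated
coefficients. -/

open InnerProductSpace

/-! ### Invertibility of combinations of rank one operators. -/

section FrameOperators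

variable {H : Type*} [NormedAddCommGroup H] [InnerProductSpace ℂ H] [FiniteDimensional ℂ H]
  {ι : Type*} [Fintype ι]

theorem isUnit_iff_forall_apply_eq_zero (T : H →L[ℂ] H) :
    IsUnit T ↔ ∀ v, T v = 0 → v = 0 := by
  have : CompleteSpace H := FiniteDimensional.complete ℂ H
  rw [ContinuousLinearMap.isUnit_iff_isUnit_toLinearMap, LinearMap.isUnit_iff_ker_eq_bot,
    LinearMap.ker_eq_bot']
  rfl

omit [FiniteDimensional ℂ H] [Fintype ι] in
theorem Module.Basis.eq_zero_of_forall_inner_eq_zero (x : Module.Basis ι ℂ H) {v : H}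
    (h : ∀ i, inner ℂ (x i) v = 0) : v = 0 :=
  InnerProductSpace.ext_inner_left_basis x fun i => by simp [h i]

theorem Module.Basis.exists_inner_eq (x : Module.Basis ι ℂ H) (d : ι → ℂ) :
    ∃ v : H, ∀ i, inner ℂ (x i) v = d i := by
  let f : H →ₗ[ℂ] (ι → ℂ) := LinearMap.pi fun i => (innerSL ℂ (x i)).toLinearMap
  have hinj : Function.Injective f := by
    rw [← LinearMap.ker_eq_bot, LinearMap.ker_eq_bot']
    intro v hv
    exact x.eq_zero_of_forall_inner_eq_zero fun i => congrFun hv i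
  have hsurj : Function.Surjective f := by
    rwa [← LinearMap.injective_iff_surjective_of_finrank_eq_finrank]
    simp [Module.finrank_eq_card_basis x]
  obtain ⟨v, hv⟩ := hsurj d
  exact ⟨v, fun i => congrFun hv i⟩

/-- A frame operator with one rank one operator subtracted is invertible off a hyperplane. -/
theorem isUnit_sum_rankOne_sub_iff (x : Module.Basis ι ℂ H) (a t : ι → ℂ) (ht : ∀ i, t i ≠ 0)
    {y : H} (hy : y = ∑ i, a i • x i) :
    IsUnit (∑ i, (t i)⁻¹ • rankOne ℂ (x i) (x i) - rankOne ℂ y y) ↔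
      ∑ i, t i * ((‖a i‖ ^ 2 : ℝ) : ℂ) ≠ 1 := by
  have hT : ∀ v, (∑ i, (t i)⁻¹ • rankOne ℂ (x i) (x i) - rankOne ℂ y y) v =
      ∑ i, ((t i)⁻¹ * inner ℂ (x i) v - inner ℂ y v * a i) • x i := by
    intro v
    simp only [_root_.sub_apply, _root_.sum_apply,
      _root_.smul_apply, rankOne_apply, sub_smul, Finset.sum_sub_distrib, mul_smul,
      ← Finset.smul_sum, ← hy]
  have hin : ∀ v, inner ℂ y v = ∑ i, (starRingEnd ℂ) (a i) * inner ℂ (x i) v := by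
    intro v
    rw [hy, sum_inner]
    simp [inner_smul_left]
  have hsq : ∀ i, ((‖a i‖ ^ 2 : ℝ) : ℂ) = (starRingEnd ℂ) (a i) * a i := by
    intro i
    rw [mul_comm, Complex.mul_conj, Complex.normSq_eq_norm_sq]
  rw [isUnit_iff_forall_apply_eq_zero]
  constructor
  · intro h h1
    -- This `v` spans the kernel: it satisfies `⟪y, v⟫ = ∑ t i |a i|² = 1`, so the two parts of the
    -- operator cancel on it.
    obtain ⟨v, hv⟩ := x.exists_inner_eq fun i => t i * a i
    have hyv : inner ℂ y v = 1 := by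
      rw [hin, ← h1]
      refine Finset.sum_congr rfl fun i _ => ?_
      rw [hv, hsq]
      ring
    have hv0 : v = 0 := by
      refine h v ?_
      rw [hT]
      refine Finset.sum_eq_zero fun i _ => ?_
      rw [hv, hyv, inv_mul_cancel_left₀ (ht i)]
      simp
    simp [hv0] at hyv
  · intro h v hv
    rw [hT] at hv
    have hc : ∀ i, inner ℂ (x i) v = t i * a i * inner ℂ y v := by
      intro i
      have h0 := Fintype.linearIndependent_iff.1 x.linearIndependent _ hv i
      have := ht i
      field_simp at h0
      linear_combination h0
    have h2 : inner ℂ y v * (∑ i, t i * ((‖a i‖ ^ 2 : ℝ) : ℂ) - 1) = 0 := by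
      rw [mul_sub, mul_one, sub_eq_zero, hin v, ← hin, Finset.mul_sum]
      conv_rhs => rw [hin]
      refine Finset.sum_congr rfl fun i _ => ?_
      rw [hc i, hsq]
      ring
    have h3 : inner ℂ y v = 0 := (mul_eq_zero.1 h2).resolve_right (sub_ne_zero.2 h)
    exact x.eq_zero_of_forall_inner_eq_zero fun i => by rw [hc, h3, mul_zero]

theorem isUnit_sum_rankOne (x : Module.Basis ι ℂ H) :
    IsUnit (∑ i, rankOne ℂ (x i) (x i)) := by
  rw [isUnit_iff_forall_apply_eq_zero]
  intro v hv
  simp only [_root_.sum_apply, rankOne_apply] at hv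
  exact x.eq_zero_of_forall_inner_eq_zero (Fintype.linearIndependent_iff.1 x.linearIndependent _ hv)

theorem span_eq_top_of_isUnit_sum_rankOne {x : ι → H}
    (h : IsUnit (∑ i, rankOne ℂ (x i) (x i))) : ⊤ ≤ Submodule.span ℂ (Set.range x) := by
  have : CompleteSpace H := FiniteDimensional.complete ℂ H
  intro v _
  obtain ⟨w, rfl⟩ := (ContinuousLinearMap.isUnit_iff_bijective.1 h).2 v
  simp only [_root_.sum_apply, rankOne_apply]
  exact Submodule.sum_mem _ fun i _ => Submodule.smul_mem _ _ (Submodule.subset_span ⟨i, rfl⟩)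

end FrameOperators

/-- Weights are determined by the affine hyperplane they define, even when only its points off
the coordinate hyperplanes are known. -/
theorem eq_of_forall_sum_mul_eq_one {ι : Type*} [Fintype ι] {p q : ι → ℝ} (hq : ∀ i, 0 ≤ q i)
    {k : ι} (hk : 0 < q k)
    (h : ∀ t : ι → ℝ, (∀ i, t i ≠ 0) → ∑ i, t i * q i = 1 → ∑ i, t i * p i = 1) : p = q := by
  classical
  set s := ∑ i, q i with hs
  have hle : ∀ i, q i ≤ s := fun i => Finset.single_le_sum (fun i _ => hq i) (Finset.mem_univ i)
  have hs0 : 0 < s := hk.trans_le (hle k)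
  have h1 : ∑ i, p i = s := by
    have := h (fun _ => s⁻¹) (fun _ => by positivity)
      (by rw [← Finset.mul_sum, ← hs, inv_mul_cancel₀ hs0.ne'])
    rw [← Finset.mul_sum] at this
    field_simp at this
    exact this
  have h2 : ∀ j, q k * p j = q j * p k := by
    intro j
    rcases eq_or_ne j k with rfl | hjk
    · rfl
    -- Move from the constant point `s⁻¹` along `q k • e j - q j • e k`, which is tangent to the
    -- hyperplane of `q`. Entries of this direction are at least `-s`, so the step `(2 * s ^ 2)⁻¹`
    -- keeps all coordinates at least `(2 * s)⁻¹`, hence nonzero.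
    have key : ∀ r : ι → ℝ, ∑ i, (s⁻¹ + (2 * s ^ 2)⁻¹ * 
      ((Pi.single j (q k) : ι → ℝ) i - (Pi.single k (q j) : ι → ℝ) i))
        * r i = s⁻¹ * ∑ i, r i + (2 * s ^ 2)⁻¹ * (q k * r j - q j * r k) := by
      intro r
      simp only [add_mul, mul_assoc, sub_mul, mul_sub, Finset.sum_add_distrib,
        Finset.sum_sub_distrib, ← Finset.mul_sum, Pi.single_apply, ite_mul, zero_mul,
        Finset.sum_ite_eq', Finset.mem_univ, if_true]
    have := h (fun i => s⁻¹ + (2 * s ^ 2)⁻¹ * ((Pi.single j (q k) : ι → ℝ) i - (Pi.single k (q j) : ι → ℝ) i)) ?_ ?_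
    · rw [key, h1, inv_mul_cancel₀ hs0.ne'] at this
      have h3 : (2 * s ^ 2)⁻¹ ≠ 0 := by positivity
      have h4 := (mul_eq_zero.1 (by linarith : (2 * s ^ 2)⁻¹ * (q k * p j - q j * p k) = 0))
      linarith [h4.resolve_left h3]
    · intro i
      apply ne_of_gt
      have h5 : -s ≤ (Pi.single j (q k) : ι → ℝ) i - (Pi.single k (q j) : ι → ℝ) i := by
        have := hle j
        have := hq k
        rcases eq_or_ne i k with rfl | hik
        · simp [hjk.symm]
          linarith
        · by_cases hij : i = j
          · subst hij
            simp [hik]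
            linarith
          · simp [hik, hij]
            linarith
      calc (0 : ℝ) < (2 * s)⁻¹ := by positivity
        _ = s⁻¹ + (2 * s ^ 2)⁻¹ * (-s) := by field_simp; norm_num
        _ ≤ _ := by gcongr
    · rw [key, ← hs, inv_mul_cancel₀ hs0.ne']
      ring
  have h3 : p k = q k := by
    have : ∑ j, q k * p j = ∑ j, q j * p k := Finset.sum_congr rfl fun j _ => h2 j
    rw [← Finset.mul_sum, ← Finset.sum_mul, h1, ← hs, mul_comm] at this
    exact (mul_left_cancel₀ hs0.ne' this).symm
  funext j
  have := h2 j
  rw [h3, mul_comm] at this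
  exact mul_right_cancel₀ hk.ne' this

/-! ### Wigner's theorem via matrix entries. -/

section Wigner

variable {H : Type*} [NormedAddCommGroup H] [InnerProductSpace ℂ H] {ι : Type*} [Fintype ι]

/-- Coordinatewise complex conjugation. -/
noncomputable def EuclideanSpace.conj (ι : Type*) [Fintype ι] :
    EuclideanSpace ℂ ι ≃ₗᵢ⋆[ℂ] EuclideanSpace ℂ ι where
  toFun x := WithLp.toLp 2 fun i => (starRingEnd ℂ) (x i)
  invFun x := WithLp.toLp 2 fun i => (starRingEnd ℂ) (x i)
  map_add' x y := by ext i; simp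
  map_smul' c x := by ext i; simp
  left_inv x := by ext i; simp
  right_inv x := by ext i; simp
  norm_map' x := by simp [EuclideanSpace.norm_eq]

theorem EuclideanSpace.conj_apply (x : EuclideanSpace ℂ ι) (i : ι) :
    EuclideanSpace.conj ι x i = (starRingEnd ℂ) (x i) := rfl

/-- The conjugate-linear isometry carrying one orthonormal basis to another. -/
noncomputable def OrthonormalBasis.conjEquiv (b b' : OrthonormalBasis ι ℂ H) : H ≃ₗᵢ⋆[ℂ] H :=
  b.repr.trans ((EuclideanSpace.conj ι).trans b'.repr.symm)

theorem OrthonormalBasis.inner_conjEquiv (b b' : OrthonormalBasis ι ℂ H) (x : H) (i : ι) :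
    inner ℂ (b' i) (b.conjEquiv b' x) = (starRingEnd ℂ) (inner ℂ (b i) x) := by
  rw [← b'.repr_apply_apply, ← b.repr_apply_apply]
  simp [OrthonormalBasis.conjEquiv, EuclideanSpace.conj_apply]

theorem OrthonormalBasis.rankOne_self_eq (b : OrthonormalBasis ι ℂ H) {x y : H}
    (h : ∀ i j, inner ℂ (b i) x * (starRingEnd ℂ) (inner ℂ (b j) x) =
      inner ℂ (b i) y * (starRingEnd ℂ) (inner ℂ (b j) y)) :
    rankOne ℂ x x = rankOne ℂ y y := by
  apply ContinuousLinearMap.coe_injective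
  refine b.toBasis.ext fun j => ?_
  refine InnerProductSpace.ext_inner_left_basis b.toBasis fun i => ?_
  have := h i j
  simp only [inner_conj_symm] at this
  simpa [inner_smul_right, mul_comm] using this

/-- Expand the squared modulus: the cross term is twice this real part. It serves test vectors
supported on two coordinates. -/
theorem re_conj_mul_of_norm_eq {a b c d a' b' c' d' : ℂ} (hac : ‖a'‖ * ‖c'‖ = ‖a‖ * ‖c‖)
    (hbd : ‖b'‖ * ‖d'‖ = ‖b‖ * ‖d‖)
    (h : ‖(starRingEnd ℂ) a' * c' + (starRingEnd ℂ) b' * d'‖ =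
      ‖(starRingEnd ℂ) a * c + (starRingEnd ℂ) b * d‖) :
    ((starRingEnd ℂ) (a' * (starRingEnd ℂ) b') * (c' * (starRingEnd ℂ) d')).re =
      ((starRingEnd ℂ) (a * (starRingEnd ℂ) b) * (c * (starRingEnd ℂ) d)).re := by
  have key : ∀ a b c d : ℂ, ‖(starRingEnd ℂ) a * c + (starRingEnd ℂ) b * d‖ ^ 2 =
      (‖a‖ * ‖c‖) ^ 2 + (‖b‖ * ‖d‖) ^ 2 +
        2 * ((starRingEnd ℂ) (a * (starRingEnd ℂ) b) * (c * (starRingEnd ℂ) d)).re := by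
    intro a b c d
    simp only [mul_pow, ← Complex.normSq_eq_norm_sq, Complex.normSq_apply, Complex.add_re,
      Complex.add_im, Complex.mul_re, Complex.mul_im, Complex.conj_re, Complex.conj_im]
    ring
  have h1 := key a b c d
  have h2 := key a' b' c' d'
  rw [h, hac, hbd, h1] at h2
  linarith

/-- **Wigner's theorem** in finite dimension. -/
theorem wigner [DecidableEq ι] [Nontrivial ι] (b : OrthonormalBasis ι ℂ H) (F : H → H)
    (hF : ∀ x y, ‖inner ℂ (F x) (F y)‖ = ‖inner ℂ x y‖) :
    (∃ V : H ≃ₗᵢ[ℂ] H, ∀ x, rankOne ℂ (F x) (F x) = rankOne ℂ (V x) (V x)) ∨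
      (∃ V : H ≃ₗᵢ⋆[ℂ] H, ∀ x, rankOne ℂ (F x) (F x) = rankOne ℂ (V x) (V x)) := by
  have : FiniteDimensional ℂ H := b.toBasis.finiteDimensional_of_finite
  set g : H := ∑ i, b i with hg
  have hbg : ∀ i, inner ℂ (b i) g = 1 := by
    intro i
    simp [hg, b.inner_eq_ite]
  have hε : ∀ i, ‖inner ℂ (F (b i)) (F g)‖ = 1 := by
    intro i
    rw [hF, hbg, norm_one]
  have hFnorm : ∀ x, ‖F x‖ = ‖x‖ := by
    intro x
    have := hF x x
    simp only [inner_self_eq_norm_sq_to_K, norm_pow, RCLike.norm_ofReal, abs_norm] at this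
    exact (sq_eq_sq₀ (norm_nonneg _) (norm_nonneg _)).1 this
  -- These phases make every coordinate of `F g` equal to one, as for `g`.
  have hon : Orthonormal ℂ fun i => inner ℂ (F (b i)) (F g) • F (b i) := by
    refine ⟨fun i => ?_, fun i j hij => ?_⟩
    · rw [norm_smul, hε, hFnorm, b.norm_eq_one, one_mul]
    · have := hF (b i) (b j)
      rw [b.inner_eq_zero hij, norm_zero, norm_eq_zero] at this
      simp [inner_smul_left, inner_smul_right, this]
  obtain ⟨b', hb'⟩ : ∃ b' : OrthonormalBasis ι ℂ H,
      ∀ i, b' i = inner ℂ (F (b i)) (F g) • F (b i) := by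
    have := hon.linearIndependent.span_eq_top_of_card_eq_finrank'
      (Module.finrank_eq_card_basis b.toBasis).symm
    exact ⟨OrthonormalBasis.mk hon this.ge, congrFun (OrthonormalBasis.coe_mk hon this.ge)⟩
  -- the coordinates and the matrix entries of `rankOne x x`, before and after `F`
  set c : H → ι → ℂ := fun x i => inner ℂ (b i) x with hc
  set c' : H → ι → ℂ := fun x i => inner ℂ (b' i) (F x) with hc'
  set w : H → ι → ι → ℂ := fun x i j => c x i * (starRingEnd ℂ) (c x j) with hw
  set w' : H → ι → ι → ℂ := fun x i j => c' x i * (starRingEnd ℂ) (c' x j) with hw'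
  have hnorm : ∀ x i, ‖c' x i‖ = ‖c x i‖ := by
    intro x i
    simp only [hc, hc', hb', inner_smul_left, norm_mul, RCLike.norm_conj, hε, one_mul, hF]
  have hg' : ∀ i, c' g i = 1 := by
    intro i
    simp only [hc', hb', inner_smul_left]
    rw [mul_comm, Complex.mul_conj, Complex.normSq_eq_norm_sq, hε]
    simp
  have hw'norm : ∀ x i j, ‖w' x i j‖ = ‖w x i j‖ := by
    intro x i j
    simp only [hw, hw', norm_mul, RCLike.norm_conj, hnorm]
  have hpair : ∀ u x i j, i ≠ j → (∀ k, k ≠ i → k ≠ j → c u k = 0) →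
      ((starRingEnd ℂ) (w' u i j) * w' x i j).re = ((starRingEnd ℂ) (w u i j) * w x i j).re := by
    intro u x i j hij hu
    have hu' : ∀ k, k ≠ i → k ≠ j → c' u k = 0 := by
      intro k hki hkj
      rw [← norm_eq_zero, hnorm, hu k hki hkj, norm_zero]
    refine re_conj_mul_of_norm_eq (by rw [hnorm, hnorm]) (by rw [hnorm, hnorm]) ?_
    have h1 : inner ℂ u x = (starRingEnd ℂ) (c u i) * c x i + (starRingEnd ℂ) (c u j) * c x j := by
      rw [← b.sum_inner_mul_inner u x]
      simp only [hc, inner_conj_symm]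
      refine Fintype.sum_eq_add i j hij fun k hk => ?_
      rw [← inner_conj_symm u, show inner ℂ (b k) u = 0 from hu k hk.1 hk.2]
      simp
    have h2 : inner ℂ (F u) (F x) =
        (starRingEnd ℂ) (c' u i) * c' x i + (starRingEnd ℂ) (c' u j) * c' x j := by
      rw [← b'.sum_inner_mul_inner (F u) (F x)]
      simp only [hc', inner_conj_symm]
      refine Fintype.sum_eq_add i j hij fun k hk => ?_
      rw [← inner_conj_symm (F u), show inner ℂ (b' k) (F u) = 0 from hu' k hk.1 hk.2]
      simp
    rw [← h1, ← h2, hF]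
  have hwg : ∀ i j, w g i j = 1 := fun i j => by simp only [hw, hc, hbg]; simp
  have hwg' : ∀ i j, w' g i j = 1 := fun i j => by simp [hw', hg']
  have hcb : ∀ i j, c (b i) j = if j = i then 1 else 0 := fun i j => b.inner_eq_ite j i
  have hcadd : ∀ x y i, c (x + y) i = c x i + c y i := fun x y i => inner_add_right _ _ _
  have hcsmul : ∀ (r : ℂ) x i, c (r • x) i = r * c x i := fun r x i => inner_smul_right _ _ _
  have hre2 : ∀ u i j, i ≠ j → (∀ k, k ≠ i → k ≠ j → c u k = 0) →
      (w' u i j).re = (w u i j).re := by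
    intro u i j hij hu
    have := hpair u g i j hij hu
    simpa [hwg, hwg'] using this
  -- Testing against `b i + b j` gives real parts; `b i + I • b j` below gives imaginary parts up to
  -- a sign `s i j`.
  have hre : ∀ x i j, i ≠ j → (w' x i j).re = (w x i j).re := by
    intro x i j hij
    have hsupp : ∀ k, k ≠ i → k ≠ j → c (b i + b j) k = 0 := by
      intro k hki hkj
      simp [hcadd, hcb, hki, hkj]
    have hwu : w (b i + b j) i j = 1 := by
      simp [hw, hcadd, hcb, hij, hij.symm]
    have hwu' : w' (b i + b j) i j = 1 := by
      have h1 := hre2 _ i j hij hsupp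
      have h2 := hw'norm (b i + b j) i j
      rw [hwu] at h1 h2
      rw [norm_one, ← sq_eq_sq₀ (norm_nonneg _) zero_le_one, ← Complex.normSq_eq_norm_sq,
        Complex.normSq_apply, h1] at h2
      apply Complex.ext
      · exact h1
      · simp at h2 ⊢
        exact h2
    have := hpair _ x i j hij hsupp
    simpa [hwu, hwu'] using this
  have him : ∀ i j, ∃ s : ℝ, i ≠ j → (s = 1 ∨ s = -1) ∧ ∀ x, (w' x i j).im = s * (w x i j).im := by
    intro i j
    by_cases hij : i = j
    · exact ⟨0, fun h => absurd hij h⟩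
    have hsupp : ∀ k, k ≠ i → k ≠ j → c (b i + Complex.I • b j) k = 0 := by
      intro k hki hkj
      simp [hcadd, hcsmul, hcb, hki, hkj]
    have hwu : w (b i + Complex.I • b j) i j = -Complex.I := by
      simp [hw, hcadd, hcsmul, hcb, hij, Ne.symm hij]
    have h1 := hre2 _ i j hij hsupp
    have h2 := hw'norm (b i + Complex.I • b j) i j
    rw [hwu] at h1 h2
    rw [norm_neg, Complex.norm_I, ← sq_eq_sq₀ (norm_nonneg _) zero_le_one,
      ← Complex.normSq_eq_norm_sq, Complex.normSq_apply, h1] at h2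
    refine ⟨-(w' (b i + Complex.I • b j) i j).im, fun _ => ⟨?_, fun x => ?_⟩⟩
    · rw [or_comm, neg_inj, neg_eq_iff_eq_neg, ← sq_eq_one_iff]
      simpa [sq] using h2
    · have h3 := hpair _ x i j hij hsupp
      rw [hwu, Complex.mul_re, Complex.conj_re, h1] at h3
      simp at h3
      have h4 : (w' (b i + Complex.I • b j) i j).im ^ 2 = 1 := by simpa [sq] using h2
      linear_combination (w' (b i + Complex.I • b j) i j).im * h3 - (w' x i j).im * h4
  choose s hs using him
  have hsymm : ∀ i j, i ≠ j → s i j = s j i := by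
    intro i j hij
    have hwu : ∀ x, (w x j i).im = -(w x i j).im := fun x => by simp [hw]; ring
    have hwu' : ∀ x, (w' x j i).im = -(w' x i j).im := fun x => by simp [hw']; ring
    have h1 := (hs i j hij).2 (b i + Complex.I • b j)
    have h2 := (hs j i hij.symm).2 (b i + Complex.I • b j)
    rw [hwu, hwu', h1] at h2
    have h3 : w (b i + Complex.I • b j) i j = -Complex.I := by
      simp [hw, hcadd, hcsmul, hcb, hij, Ne.symm hij]
    rw [h3] at h2
    simpa using h2
  have htrans : ∀ i j k, i ≠ j → j ≠ k → i ≠ k → s i j = s j k := by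
    intro i j k hij hjk hik
    -- As `|c' x j| = 1`, the identity `w' i j * w' j k = w' i k` holds at this `x`; its real part
    -- reads `s i j * s j k = 1`.
    set x : H := b j + Complex.I • b i + Complex.I • b k with hx
    have hci : c x i = Complex.I := by simp [hx, hcadd, hcsmul, hcb, hij, hik]
    have hcj : c x j = 1 := by simp [hx, hcadd, hcsmul, hcb, hij.symm, hjk]
    have hck : c x k = Complex.I := by simp [hx, hcadd, hcsmul, hcb, hik.symm, hjk.symm]
    have hwij : w x i j = Complex.I := by simp [hw, hci, hcj]
    have hwjk : w x j k = -Complex.I := by simp [hw, hck, hcj]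
    have hwik : w x i k = 1 := by simp [hw, hci, hck]
    have h1 : (w' x i j * w' x j k).re = 1 := by
      have : w' x i j * w' x j k = w' x i k := by
        have hj : (starRingEnd ℂ) (c' x j) * c' x j = 1 := by
          rw [mul_comm, Complex.mul_conj, Complex.normSq_eq_norm_sq, hnorm, hcj]
          simp
        simp only [hw']
        linear_combination (c' x i * (starRingEnd ℂ) (c' x k)) * hj
      rw [this, hre x i k hik, hwik, Complex.one_re]
    rw [Complex.mul_re, hre x i j hij, hre x j k hjk, (hs i j hij).2, (hs j k hjk).2, hwij,
      hwjk] at h1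
    simp at h1
    rcases (hs i j hij).1 with h | h <;> rcases (hs j k hjk).1 with h' | h' <;>
      rw [h, h'] at h1 ⊢ <;> norm_num at h1
  have hconst : ∃ σ : ℝ, (σ = 1 ∨ σ = -1) ∧ ∀ i j, i ≠ j → s i j = σ := by
    obtain ⟨o, p, hop⟩ := exists_pair_ne ι
    have hstar : ∀ j, j ≠ o → s o j = s o p := by
      intro j hj
      rcases eq_or_ne j p with rfl | hjp
      · rfl
      rw [hsymm o j hj.symm]
      exact htrans j o p hj hop hjp
    refine ⟨s o p, (hs o p hop).1, fun i j hij => ?_⟩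
    rcases eq_or_ne i o with rfl | hi
    · exact hstar j hij.symm
    rcases eq_or_ne j o with rfl | hj
    · rw [hsymm i j hij]
      exact hstar i hi
    · rw [htrans i j o hij hj hi, hsymm j o hj]
      exact hstar j hj
  have hdiag : ∀ x i, w' x i i = w x i i := by
    intro x i
    simp only [hw, hw', Complex.mul_conj, Complex.normSq_eq_norm_sq, hnorm]
  -- The common sign decides: `1` means equal matrices, hence a linear isometry; `-1` means
  -- conjugate matrices, hence a conjugate-linear one.
  obtain ⟨σ, hσ | hσ, hall⟩ := hconst
  · left
    refine ⟨b.equiv b' (Equiv.refl ι), fun x => b'.rankOne_self_eq fun i j => ?_⟩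
    have hV : ∀ i, inner ℂ (b' i) (b.equiv b' (Equiv.refl ι) x) = c x i := by
      intro i
      rw [← b'.repr_apply_apply]
      simp [OrthonormalBasis.equiv, hc, b.repr_apply_apply]
    rw [hV, hV]
    change w' x i j = w x i j
    rcases eq_or_ne i j with rfl | hij
    · exact hdiag x i
    · exact Complex.ext (hre x i j hij) (by rw [(hs i j hij).2, hall i j hij, hσ, one_mul])
  · right
    refine ⟨b.conjEquiv b', fun x => b'.rankOne_self_eq fun i j => ?_⟩
    rw [b.inner_conjEquiv, b.inner_conjEquiv, ← map_mul]
    change w' x i j = (starRingEnd ℂ) (w x i j)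
    rcases eq_or_ne i j with rfl | hij
    · rw [hdiag]
      simp [hw, mul_comm]
    · refine Complex.ext ?_ ?_
      · rw [hre x i j hij, Complex.conj_re]
      · rw [(hs i j hij).2, hall i j hij, hσ, Complex.conj_im]
        ring

end Wigner

/-! ### Rank one projections and unit vectors. -/

section RankOneProj

variable {H : Type*} [NormedAddCommGroup H] [InnerProductSpace ℂ H] [CompleteSpace H]

omit [CompleteSpace H] in
theorem finrank_range_rankOne_self {x : H} (hx : ‖x‖ = 1) :
    Module.finrank ℂ (rankOne ℂ x x).range = 1 := by
  have hx0 : x ≠ 0 := norm_ne_zero_iff.1 (by rw [hx]; exact one_ne_zero)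
  have : (rankOne ℂ x x).range = Submodule.span ℂ {x} := by
    ext v
    rw [Submodule.mem_span_singleton]
    constructor
    · rintro ⟨w, rfl⟩
      exact ⟨_, rfl⟩
    · rintro ⟨r, rfl⟩
      refine ⟨r • x, ?_⟩
      simp [inner_self_eq_norm_sq_to_K, hx]
  rw [this, finrank_span_singleton hx0]

/-- The projection onto the line spanned by a unit vector. -/
noncomputable def RankOneProj.ofUnit (x : H) (hx : ‖x‖ = 1) : RankOneProj H :=
  ⟨rankOne ℂ x x, isStarProjection_rankOne_self hx, finrank_range_rankOne_self hx⟩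

theorem RankOneProj.exists_unit (P : RankOneProj H) : ∃ x : H, ‖x‖ = 1 ∧ P.1 = rankOne ℂ x x := by
  obtain ⟨P, hP, hr⟩ := P
  obtain ⟨⟨v, hv⟩, hv0, hspan⟩ := finrank_eq_one_iff'.1 hr
  have hv0' : v ≠ 0 := fun h => hv0 (Subtype.ext h)
  have hPv : P v = v := by
    obtain ⟨w, rfl⟩ := hv
    exact congrArg (fun T : H →L[ℂ] H => T w) hP.isIdempotentElem
  have hsymm : ∀ y z, inner ℂ (P y) z = inner ℂ y (P z) := fun y z => by
    have := ContinuousLinearMap.adjoint_inner_left P z y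
    rwa [← ContinuousLinearMap.star_eq_adjoint, hP.isSelfAdjoint.star_eq] at this
  have hn : ‖v‖ ≠ 0 := norm_ne_zero_iff.2 hv0'
  refine ⟨(‖v‖⁻¹ : ℂ) • v, ?_, ?_⟩
  · rw [norm_smul, norm_inv, Complex.norm_real, norm_norm, inv_mul_cancel₀ hn]
  · ext y
    obtain ⟨c, hc⟩ := hspan ⟨P y, y, rfl⟩
    have hc' : c • v = P y := congrArg Subtype.val hc
    have h1 : inner ℂ v y = c * (‖v‖ : ℂ) ^ 2 := by
      rw [← hPv, hsymm, ← hc', inner_smul_right, inner_self_eq_norm_sq_to_K, hPv]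
      rfl
    rw [rankOne_apply, inner_smul_left, h1, ← hc', smul_smul]
    congr 1
    have : (‖v‖ : ℂ) ≠ 0 := by exact_mod_cast hn
    simp
    field_simp

/-- A unit vector spanning the range of a rank one projection. -/
noncomputable def RankOneProj.vec (P : RankOneProj H) : H := P.exists_unit.choose

theorem RankOneProj.norm_vec (P : RankOneProj H) : ‖P.vec‖ = 1 := P.exists_unit.choose_spec.1

theorem RankOneProj.eq_rankOne_vec (P : RankOneProj H) : P.1 = rankOne ℂ P.vec P.vec :=
  P.exists_unit.choose_spec.2

theorem RankOneProj.exists_eq_smul_vec {x : H} (hx : ‖x‖ = 1) :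
    ∃ c : ℂ, ‖c‖ = 1 ∧ x = c • (RankOneProj.ofUnit x hx).vec := by
  set P := RankOneProj.ofUnit x hx
  have h : rankOne ℂ x x = rankOne ℂ P.vec P.vec := P.eq_rankOne_vec
  have h1 : x = (inner ℂ P.vec x : ℂ) • P.vec := by
    have := congrArg (fun T : H →L[ℂ] H => T x) h
    simpa [inner_self_eq_norm_sq_to_K, hx] using this
  refine ⟨_, ?_, h1⟩
  have := congrArg norm h1
  rwa [norm_smul, P.norm_vec, mul_one, hx, eq_comm] at this

/-- Shrinking for tuples of length at least `l + 1`, in terms of invertible combinations. -/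
theorem ShrinksJointSpectrum.isUnit {φ : RankOneProj H → RankOneProj H} {k l : ℕ}
    (h : ShrinksJointSpectrum φ k) (hk : l + 1 ≤ k) (P : Fin l → RankOneProj H)
    (Q : RankOneProj H) (c : Fin l → ℂ) (d : ℂ) (hu : IsUnit (∑ i, c i • (P i).1 + d • Q.1)) :
    IsUnit (∑ i, c i • (φ (P i)).1 + d • (φ Q).1) := by
  obtain ⟨m, rfl⟩ := Nat.exists_eq_add_of_le hk
  -- Surplus slots hold copies of `Q` with coefficient zero, so both sums are unchanged.
  have := @h (Fin.append (Fin.snoc P Q) fun _ => Q) (Fin.append (Fin.snoc c d) fun _ => 0)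
  simp only [jointSpectrum, Set.mem_ofPred_eq, Fin.sum_univ_add, Fin.append_left, Fin.append_right,
    Fin.sum_univ_castSucc, Fin.snoc_castSucc, Fin.snoc_last, zero_smul,
    Finset.sum_const_zero, add_zero] at this
  exact not_imp_not.1 this hu

end RankOneProj

/-! ### Preservation of transition probabilities. -/

section Transition

variable {H : Type*} [NormedAddCommGroup H] [InnerProductSpace ℂ H] [CompleteSpace H]
  [FiniteDimensional ℂ H] {φ : RankOneProj H → RankOneProj H} {k l : ℕ}

/-- The sum of the `P i` is invertible, hence so is the sum of their images; its range lies in the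
span of the image vectors, and there are only `l` of them. -/
theorem ShrinksJointSpectrum.exists_basis (h : ShrinksJointSpectrum φ k)
    (hdim : Module.finrank ℂ H = l) (hk : l + 1 ≤ k) (P : Fin l → RankOneProj H)
    (x : Module.Basis (Fin l) ℂ H) (hx : ∀ i, (P i).1 = rankOne ℂ (x i) (x i)) :
    ∃ x' : Module.Basis (Fin l) ℂ H, ∀ i, x' i = (φ (P i)).vec := by
  rcases Nat.eq_zero_or_pos l with rfl | hl
  · exact ⟨x, fun i => i.elim0⟩
  have h1 := h.isUnit hk P (P ⟨0, hl⟩) (fun _ => 1) 0 (by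
    simpa [hx] using isUnit_sum_rankOne x)
  simp only [one_smul, zero_smul, add_zero, RankOneProj.eq_rankOne_vec (φ _)] at h1
  have h2 := span_eq_top_of_isUnit_sum_rankOne h1
  have h3 := linearIndependent_of_top_le_span_of_card_eq_finrank h2 (by simp [hdim])
  exact ⟨Module.Basis.mk h3 h2, fun i => by simp⟩

theorem ShrinksJointSpectrum.norm_coeff_eq (h : ShrinksJointSpectrum φ k)
    (hk : l + 1 ≤ k) (P : Fin l → RankOneProj H)
    (x x' : Module.Basis (Fin l) ℂ H) (hx : ∀ i, (P i).1 = rankOne ℂ (x i) (x i))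
    (hx' : ∀ i, (φ (P i)).1 = rankOne ℂ (x' i) (x' i)) (Q : RankOneProj H) {y y' : H}
    (hy : Q.1 = rankOne ℂ y y) (hy' : (φ Q).1 = rankOne ℂ y' y') (hy0 : y' ≠ 0) (i : Fin l) :
    ‖x'.repr y' i‖ = ‖x.repr y i‖ := by
  obtain ⟨j, hj⟩ : ∃ j, x'.repr y' j ≠ 0 := by
    by_contra! hall
    exact hy0 (x'.ext_elem fun j => by simp [hall j])
  -- Shrinking carries singularity from the image to the source, so the image weights play the role
  -- of `q`; one inclusion suffices.
  have key : (fun i => ‖x.repr y i‖ ^ 2) = fun i => ‖x'.repr y' i‖ ^ 2 := by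
    refine eq_of_forall_sum_mul_eq_one (fun i => by positivity) (k := j) (by positivity)
      fun t ht ht1 => ?_
    have ht' : ∀ i, (t i : ℂ) ≠ 0 := fun i => by exact_mod_cast ht i
    have h1 := isUnit_sum_rankOne_sub_iff x (x.repr y) (fun i => (t i : ℂ)) ht' (x.sum_repr y).symm
    have h2 := isUnit_sum_rankOne_sub_iff x' (x'.repr y') (fun i => (t i : ℂ)) ht'
      (x'.sum_repr y').symm
    have h3 := h.isUnit hk P Q (fun i => (t i : ℂ)⁻¹) (-1)
    simp only [hx, hx', hy, hy', neg_smul, one_smul, ← sub_eq_add_neg] at h3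
    rw [h1, h2, not_imp_not] at h3
    exact_mod_cast h3 (by exact_mod_cast ht1)
  exact ((sq_eq_sq₀ (norm_nonneg _) (norm_nonneg _)).1 (congrFun key i)).symm

/-- Images of orthonormal bases are orthonormal. -/
theorem ShrinksJointSpectrum.exists_orthonormalBasis (h : ShrinksJointSpectrum φ k)
    (hφ : Function.Surjective φ) (hdim : Module.finrank ℂ H = l) (hk : l + 1 ≤ k)
    (b : OrthonormalBasis (Fin l) ℂ H) :
    ∃ b' : OrthonormalBasis (Fin l) ℂ H,
      (∀ i, b' i = (φ (RankOneProj.ofUnit (b i) (b.norm_eq_one i))).vec) ∧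
      ∀ Q : RankOneProj H, ∀ i, ‖inner ℂ (b' i) (φ Q).vec‖ = ‖inner ℂ (b i) Q.vec‖ := by
  set P : Fin l → RankOneProj H := fun i => RankOneProj.ofUnit (b i) (b.norm_eq_one i) with hP
  have hx : ∀ i, (P i).1 = rankOne ℂ (b.toBasis i) (b.toBasis i) := fun i => by
    rw [b.coe_toBasis]; rfl
  obtain ⟨x', hx'⟩ := h.exists_basis hdim hk P b.toBasis hx
  have hcoef : ∀ Q : RankOneProj H, ∀ y', (φ Q).1 = rankOne ℂ y' y' → y' ≠ 0 → ∀ i,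
      ‖x'.repr y' i‖ = ‖inner ℂ (b i) Q.vec‖ := by
    intro Q y' hy' hy0 i
    rw [h.norm_coeff_eq hk P b.toBasis x' hx (fun i => by rw [hx', ← RankOneProj.eq_rankOne_vec]) Q
      Q.eq_rankOne_vec hy' hy0 i, b.coe_toBasis_repr_apply, b.repr_apply_apply]
  -- Surjectivity enters here: every line is an image. The coordinate map of `x'` is therefore
  -- isometric, which makes `x'` orthonormal.
  have hunit : ∀ y', ‖y'‖ = 1 → ∑ i, ‖x'.repr y' i‖ ^ 2 = 1 := by
    intro y' hy'
    obtain ⟨Q, hQ⟩ := hφ (RankOneProj.ofUnit y' hy')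
    have hQ' : (φ Q).1 = rankOne ℂ y' y' := congrArg Subtype.val hQ
    have hy0 : y' ≠ 0 := norm_ne_zero_iff.1 (by rw [hy']; exact one_ne_zero)
    simp only [hcoef Q y' hQ' hy0, b.sum_sq_norm_inner_right, Q.norm_vec, one_pow]
  have hsum : ∀ y, ∑ i, ‖x'.repr y i‖ ^ 2 = ‖y‖ ^ 2 := by
    intro y
    rcases eq_or_ne y 0 with rfl | hy
    · simp
    have hn : ‖y‖ ≠ 0 := norm_ne_zero_iff.2 hy
    have := hunit ((‖y‖⁻¹ : ℂ) • y) (by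
      rw [norm_smul, norm_inv, Complex.norm_real, norm_norm, inv_mul_cancel₀ hn])
    simp only [map_smul, Finsupp.smul_apply, norm_smul, norm_inv, Complex.norm_real, norm_norm,
      mul_pow, ← Finset.mul_sum] at this
    field_simp at this
    exact this
  let e : H ≃ₗᵢ[ℂ] EuclideanSpace ℂ (Fin l) :=
    { x'.equivFun.trans (WithLp.linearEquiv 2 ℂ (Fin l → ℂ)).symm with
      norm_map' := fun y => by
        rw [EuclideanSpace.norm_eq, ← Real.sqrt_sq (norm_nonneg y), ← hsum y]
        rfl }
  have hb' : ∀ i, (OrthonormalBasis.ofRepr e) i = x' i := by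
    intro i
    apply e.injective
    refine ((OrthonormalBasis.ofRepr e).repr_self i).trans ?_
    ext j
    change _ = x'.repr (x' i) j
    simp [Finsupp.single_apply, eq_comm]
  refine ⟨OrthonormalBasis.ofRepr e, fun i => by rw [hb', hx'], fun Q i => ?_⟩
  rw [← hcoef Q _ (φ Q).eq_rankOne_vec (norm_ne_zero_iff.1 (by rw [(φ Q).norm_vec]; simp)),
    ← OrthonormalBasis.repr_apply_apply]
  rfl

/-- A surjective map shrinking joint spectra preserves transition probabilities. -/
theorem ShrinksJointSpectrum.norm_inner_vec (h : ShrinksJointSpectrum φ k)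
    (hφ : Function.Surjective φ) (hl : 0 < l) (hdim : Module.finrank ℂ H = l) (hk : l + 1 ≤ k)
    (P Q : RankOneProj H) :
    ‖inner ℂ (φ P).vec (φ Q).vec‖ = ‖inner ℂ P.vec Q.vec‖ := by
  obtain ⟨b, hb⟩ := Orthonormal.exists_orthonormalBasis_extension_of_card_eq (𝕜 := ℂ)
    (ι := Fin l) (by simp [hdim]) (v := fun _ => P.vec) (s := {⟨0, hl⟩}) (by
      refine ⟨fun i => P.norm_vec, fun i j hij => absurd (Subsingleton.elim i j) hij⟩)
  obtain ⟨b', hb', hQ⟩ := h.exists_orthonormalBasis hφ hdim hk b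
  have hb0 : b ⟨0, hl⟩ = P.vec := hb _ rfl
  have h0 : RankOneProj.ofUnit (b ⟨0, hl⟩) (b.norm_eq_one _) = P := by
    apply Subtype.ext
    rw [P.eq_rankOne_vec, ← hb0]
    rfl
  have := hQ Q ⟨0, hl⟩
  rwa [hb', h0, hb0] at this

end Transition

/-! ### Conjugation preserves joint spectra. -/

section Conjugation

variable {H : Type*} [NormedAddCommGroup H] [InnerProductSpace ℂ H]

theorem antiunitaryConj_mul (U : H ≃ₗᵢ⋆[ℂ] H) (A B : H →L[ℂ] H) :
    antiunitaryConj U (A * B) = antiunitaryConj U A * antiunitaryConj U B := by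
  ext x
  simp [antiunitaryConj_apply]

theorem antiunitaryConj_one (U : H ≃ₗᵢ⋆[ℂ] H) : antiunitaryConj U 1 = 1 := by
  ext x
  simp [antiunitaryConj_apply]

theorem antiunitaryConj_symm_antiunitaryConj (U : H ≃ₗᵢ⋆[ℂ] H) (A : H →L[ℂ] H) :
    antiunitaryConj U.symm (antiunitaryConj U A) = A := by
  ext x
  simp [antiunitaryConj_apply]

theorem IsUnit.antiunitaryConj {A : H →L[ℂ] H} (hA : IsUnit A) (U : H ≃ₗᵢ⋆[ℂ] H) :
    IsUnit (antiunitaryConj U A) := by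
  obtain ⟨u, rfl⟩ := hA
  refine isUnit_iff_exists.2 ⟨_root_.antiunitaryConj U ↑u⁻¹, ?_, ?_⟩ <;>
    rw [← antiunitaryConj_mul] <;> simp [antiunitaryConj_one]

theorem isUnit_antiunitaryConj_iff (U : H ≃ₗᵢ⋆[ℂ] H) (A : H →L[ℂ] H) :
    IsUnit (antiunitaryConj U A) ↔ IsUnit A :=
  ⟨fun h => by simpa [antiunitaryConj_symm_antiunitaryConj] using h.antiunitaryConj U.symm,
    fun h => h.antiunitaryConj U⟩

theorem antiunitaryConj_sum_smul (U : H ≃ₗᵢ⋆[ℂ] H) {k : ℕ} (c : Fin k → ℂ)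
    (A : Fin k → (H →L[ℂ] H)) :
    antiunitaryConj U (∑ i, c i • A i) =
      ∑ i, (starRingEnd ℂ) (c i) • antiunitaryConj U (A i) := by
  ext x
  simp [antiunitaryConj_apply, LinearIsometryEquiv.map_smulₛₗ]

variable [CompleteSpace H] {φ : RankOneProj H → RankOneProj H}

theorem preservesJointSpectrum_of_unitary {U : H →L[ℂ] H} (hU : U ∈ unitary (H →L[ℂ] H))
    (h : ∀ P, (φ P).1 = star U * P.1 * U) (k : ℕ) : PreservesJointSpectrum φ k := by
  intro P
  ext c
  have : ∑ i, c i • (φ (P i)).1 = star U * (∑ i, c i • (P i).1) * U := by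
    simp only [h, Finset.mul_sum, Finset.sum_mul, mul_smul_comm, smul_mul_assoc]
  have hu : IsUnit U := (Unitary.toUnits ⟨U, hU⟩).isUnit
  simp only [jointSpectrum, Set.mem_ofPred_eq, this]
  rw [hu.mul_right_iff, hu.star.mul_left_iff]

theorem preservesJointSpectrum_of_antiunitary (U : H ≃ₗᵢ⋆[ℂ] H)
    (h : ∀ P, (φ P).1 = antiunitaryConj U P.1) (k : ℕ) : PreservesJointSpectrum φ k := by
  intro P
  ext c
  -- The adjoint conjugates the coefficients and fixes the projections, offsetting the
  -- conjugate-linearity of `antiunitaryConj U`.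
  have : ∑ i, c i • (φ (P i)).1 = antiunitaryConj U (star (∑ i, c i • (P i).1)) := by
    have hs : ∀ i, star (P i).1 = (P i).1 := fun i => (P i).2.1.isSelfAdjoint.star_eq
    simp only [h, star_sum, star_smul, hs, antiunitaryConj_sum_smul, starRingEnd_apply, star_star]
  simp only [jointSpectrum, Set.mem_ofPred_eq, this, isUnit_antiunitaryConj_iff, isUnit_star]

theorem PreservesJointSpectrum.shrinks {k : ℕ} (h : PreservesJointSpectrum φ k) :
    ShrinksJointSpectrum φ k := fun P => (h P).subset

omit [CompleteSpace H] in
theorem antiunitaryConj_rankOne (U : H ≃ₗᵢ⋆[ℂ] H) (x : H) :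
    antiunitaryConj U (rankOne ℂ x x) = rankOne ℂ (U.symm x) (U.symm x) := by
  ext y
  rw [antiunitaryConj_apply, rankOne_apply, rankOne_apply, LinearIsometryEquiv.map_smulₛₗ,
    inner_conj_symm, inner_antiunitary_symm_left]

end Conjugation

/-- Writing each vector as a scalar times a chosen unit vector lifts `φ` to a map of `H` preserving
moduli of inner products, to which `wigner` applies. The isometry `V` it yields acts by `V P V⁻¹`,
so `U` is the inverse of `V`. -/
theorem ShrinksJointSpectrum.exists_unitary_or_antiunitary {H : Type*} [NormedAddCommGroup H]
    [InnerProductSpace ℂ H] [CompleteSpace H] [FiniteDimensional ℂ H] {n k : ℕ} (hn : 2 ≤ n)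
    (hdim : Module.finrank ℂ H = n) {φ : RankOneProj H → RankOneProj H}
    (hφ : Function.Surjective φ) (hk : n + 1 ≤ k) (h : ShrinksJointSpectrum φ k) :
    (∃ U ∈ unitary (H →L[ℂ] H), ∀ P : RankOneProj H, (φ P).1 = star U * P.1 * U) ∨
      (∃ U : H ≃ₗᵢ⋆[ℂ] H, ∀ P : RankOneProj H, (φ P).1 = antiunitaryConj U P.1) := by
  have hinner := h.norm_inner_vec hφ (by omega) hdim hk
  have : Nontrivial (Fin n) := Fin.nontrivial_iff_two_le.2 hn
  let b : OrthonormalBasis (Fin n) ℂ H := (stdOrthonormalBasis ℂ H).reindex (finCongr hdim)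
  have hrep : ∀ x : H, ∃ (c : ℂ) (P : RankOneProj H), x = c • P.vec ∧
      ∀ hx : ‖x‖ = 1, P = RankOneProj.ofUnit x hx := by
    intro x
    rcases eq_or_ne x 0 with rfl | hx
    · exact ⟨0, RankOneProj.ofUnit (b ⟨0, by omega⟩) (b.norm_eq_one _), by simp, by simp⟩
    have hn : ‖x‖ ≠ 0 := norm_ne_zero_iff.2 hx
    have h1 : ‖(‖x‖⁻¹ : ℂ) • x‖ = 1 := by
      rw [norm_smul, norm_inv, Complex.norm_real, norm_norm, inv_mul_cancel₀ hn]
    obtain ⟨c, -, hc⟩ := RankOneProj.exists_eq_smul_vec h1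
    refine ⟨‖x‖ * c, RankOneProj.ofUnit _ h1, ?_, fun hx => ?_⟩
    · rw [mul_smul, ← hc, smul_inv_smul₀ (by exact_mod_cast hn)]
    · apply Subtype.ext
      simp [RankOneProj.ofUnit, hx]
  choose c R hcR hR using hrep
  have hF : ∀ x y, ‖inner ℂ (c x • (φ (R x)).vec) (c y • (φ (R y)).vec)‖ = ‖inner ℂ x y‖ := by
    intro x y
    conv_rhs => rw [hcR x, hcR y]
    simp only [inner_smul_left, inner_smul_right, norm_mul, hinner]
  have hφF : ∀ P : RankOneProj H,
      (φ P).1 = rankOne ℂ (c P.vec • (φ (R P.vec)).vec) (c P.vec • (φ (R P.vec)).vec) := by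
    intro P
    have hRP : R P.vec = P := by
      rw [hR P.vec P.norm_vec]
      exact Subtype.ext P.eq_rankOne_vec.symm
    have hc1 : ‖c P.vec‖ = 1 := by
      have := congrArg norm (hcR P.vec)
      rwa [norm_smul, RankOneProj.norm_vec, RankOneProj.norm_vec, mul_one, eq_comm] at this
    rw [hRP, (φ P).eq_rankOne_vec]
    ext y
    simp only [rankOne_apply, inner_smul_left, smul_smul]
    congr 1
    rw [mul_right_comm, mul_comm ((starRingEnd ℂ) _), Complex.mul_conj, Complex.normSq_eq_norm_sq, hc1]
    simp
  rcases wigner b _ hF with ⟨V, hV⟩ | ⟨V, hV⟩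
  · left
    refine ⟨_, (Unitary.linearIsometryEquiv.symm V.symm).2, fun P => ?_⟩
    rw [hφF, hV, Unitary.coe_symm_linearIsometryEquiv_apply, LinearIsometryEquiv.star_eq_symm,
      LinearIsometryEquiv.symm_symm]
    conv_rhs => rw [P.eq_rankOne_vec]
    ext y
    simp [← V.inner_map_map P.vec]
  · right
    refine ⟨V.symm, fun P => ?_⟩
    rw [hφF, hV]
    conv_rhs => rw [P.eq_rankOne_vec]
    rw [antiunitaryConj_rankOne, LinearIsometryEquiv.symm_symm]

theorem theorem1p4 {H : Type*} [NormedAddCommGroup H] [InnerProductSpace ℂ H] [CompleteSpace H]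
    [FiniteDimensional ℂ H] (n : ℕ) (hn : 3 ≤ n) (hdim : Module.finrank ℂ H = n)
    (φ : RankOneProj H → RankOneProj H) (hφ : Function.Surjective φ) :
    List.TFAE [
      ∃ k₀ : ℕ, n + 1 ≤ k₀ ∧ ShrinksJointSpectrum φ k₀,
      ∃ k₀ : ℕ, n + 1 ≤ k₀ ∧ PreservesJointSpectrum φ k₀,
      ∀ k : ℕ, n + 1 ≤ k → ShrinksJointSpectrum φ k,
      ∀ k : ℕ, n + 1 ≤ k → PreservesJointSpectrum φ k,
      (∃ U ∈ unitary (H →L[ℂ] H), ∀ P : RankOneProj H, (φ P).1 = star U * P.1 * U) ∨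
        (∃ U : H ≃ₗᵢ⋆[ℂ] H, ∀ P : RankOneProj H, (φ P).1 = antiunitaryConj U P.1)] := by
  tfae_have 1 → 5 := fun ⟨_, hk, h⟩ =>
    h.exists_unitary_or_antiunitary (by omega) hdim hφ hk
  tfae_have 5 → 4 := by
    rintro (⟨U, hU, h⟩ | ⟨U, h⟩) k -
    · exact preservesJointSpectrum_of_unitary hU h k
    · exact preservesJointSpectrum_of_antiunitary U h k
  tfae_have 4 → 3 := fun h k hk => (h k hk).shrinks
  tfae_have 4 → 2 := fun h => ⟨n + 1, le_rfl, h _ le_rfl⟩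
  tfae_have 3 → 1 := fun h => ⟨n + 1, le_rfl, h _ le_rfl⟩
  tfae_have 2 → 1 := fun ⟨k, hk, h⟩ => ⟨k, hk, h.shrinks⟩
  tfae_finish
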